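/- Let $C[0,1]$ be the Banach space of real-valued continuous functions on $[0,1]$ with the supremum norm $\|\cdot\|_\infty$. There exists an equivalent norm $\|\cdot\|$ on $C[0,1]$ with the following property: for every $x\in C[0,1]$ with $\|x\|=1$, every sequence $(T_n)$ of compact linear operators on $C[0,1]$ with $\lim_n\|T_nx-x\|_\infty=0$, and every $\lambda>0$, the condition $$\lim_n\lim_{\varepsilon\to0^+}\sup\bigl\{\|(1+\lambda)T_ny-\lambda y\| : y\in C[0,1],\ \|y\|\le 1,\ \|T_n(x-y)\|_\infty\le\varepsilon\bigr\}=1$$ does not hold; that is, the limit over $n$ either does not exist or is different from $1$. -/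

import Mathlib

open Filter Topology

noncomputable section

/-- `N` is an equivalent norm on the normed space `E`: a seminorm bounded above and below by
positive multiples of the given norm (the lower bound makes it a norm). -/
def IsEquivalentNorm {E : Type*} [NormedAddCommGroup E] [NormedSpace ℝ E]
    (N : Seminorm ℝ E) : Prop :=
  ∃ a : ℝ, 0 < a ∧ ∃ b : ℝ, 0 < b ∧ ∀ u : E, a * ‖u‖ ≤ N u ∧ N u ≤ b * ‖u‖

/-- `sup { N ((1 + lam) T y - lam y) : N y ≤ 1, ‖T (x - y)‖ ≤ ε }`. For an equivalent norm `N`,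
`N x ≤ 1` and `ε ≥ 0` the set is non-empty (take `y = x`) and bounded above (`T` is bounded), so
this is a genuine supremum. -/
def localSup {E : Type*} [NormedAddCommGroup E] [NormedSpace ℝ E]
    (N : Seminorm ℝ E) (T : E →L[ℝ] E) (x : E) (lam ε : ℝ) : ℝ :=
  sSup {r : ℝ | ∃ y : E, N y ≤ 1 ∧ ‖T (x - y)‖ ≤ ε ∧ r = N ((1 + lam) • T y - lam • y)}

/-- The iterated limit
`lim_n lim_{ε → 0+} sup { N ((1 + lam) T_n y - lam y) : N y ≤ 1, ‖T_n (x - y)‖ ≤ ε } = 1`. -/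
def LocalApproxCondition {E : Type*} [NormedAddCommGroup E] [NormedSpace ℝ E]
    (N : Seminorm ℝ E) (T : ℕ → E →L[ℝ] E) (x : E) (lam : ℝ) : Prop :=
  ∃ L : ℕ → ℝ,
    (∀ n, Tendsto (fun ε : ℝ => localSup N (T n) x lam ε) (𝓝[>] 0) (𝓝 (L n))) ∧
    Tendsto L atTop (𝓝 1)

end

/-! The supremum norm itself works. Near a point `s` where `|x|` almost peaks, compactness yields
two tents at `s` of different widths whose products with `x` have nearly equal images under `T`.
Subtracting twice the difference of these products from `x` gives `y` in the unit ball with `T y ≈ T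
x`, while at some `t` near `s` the value `y t` is a nonpositive multiple of `x t`. If also `T x ≈
x`, then `|(1 + lam) * T y t - lam * y t|` is at least about `1 + lam`, so any limit is at least `1
+ lam > 1`. -/

open unitInterval in
/-- The tent of height one and slope `k` centred at `s`. -/
def tent (s : I) (k : ℕ) : C(I, ℝ) where
  toFun t := max 0 (1 - k * dist t s)
  continuous_toFun := by fun_prop

open unitInterval in
theorem tent_apply (s : I) (k : ℕ) (t : I) : tent s k t = max 0 (1 - k * dist t s) := rfl

open unitInterval in
theorem tent_antitone (s t : I) {k m : ℕ} (h : k ≤ m) : tent s m t ≤ tent s k t := by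
  simp only [tent_apply]
  gcongr

open unitInterval in
theorem abs_one_sub_two_mul_tent_sub_le (s t : I) {k m : ℕ} (h : k ≤ m) :
    |1 - 2 * (tent s k t - tent s m t)| ≤ 1 := by
  have h₁ := tent_antitone s t h
  have h₂ : 0 ≤ tent s m t := le_max_left _ _
  have h₃ : tent s k t ≤ 1 := by
    rw [tent_apply]
    exact max_le zero_le_one (sub_le_self _ (by positivity))
  rw [abs_le]
  constructor <;> linarith

/-- A compact operator maps a bounded sequence to one with a Cauchy subsequence. -/
theorem IsCompactOperator.exists_subseq_cauchySeq {E F : Type*} [NormedAddCommGroup E]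
    [NormedSpace ℝ E] [NormedAddCommGroup F] [NormedSpace ℝ F] {T : E →L[ℝ] F}
    (hT : IsCompactOperator T) {u : ℕ → E} {r : ℝ} (hu : ∀ k, ‖u k‖ ≤ r) :
    ∃ φ : ℕ → ℕ, StrictMono φ ∧ CauchySeq fun j => T (u (φ j)) := by
  have hK : IsCompact (closure (T '' Metric.closedBall 0 r)) :=
    IsCompactOperator.isCompact_closure_image_closedBall (f := T.toLinearMap) hT r
  obtain ⟨a, -, φ, hφ, ha⟩ := hK.tendsto_subseq (x := fun k => T (u k)) fun k =>
    subset_closure ⟨u k, by simpa using hu k, rfl⟩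
  exact ⟨φ, hφ, ha.cauchySeq⟩

open unitInterval in
/-- A norm-one function can be reflected on a small set near its peak, at an arbitrarily small
cost for a given compact operator. -/
theorem exists_reflection {T : C(I, ℝ) →L[ℝ] C(I, ℝ)} (hT : IsCompactOperator T)
    {x : C(I, ℝ)} (hx : ‖x‖ = 1) {ε : ℝ} (hε : 0 < ε) :
    ∃ y : C(I, ℝ), ‖y‖ ≤ 1 ∧ ‖T (x - y)‖ ≤ ε ∧
      ∃ (t : I) (c : ℝ), c ≤ 0 ∧ 1 - ε ≤ |x t| ∧ y t = c * x t := by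
  obtain ⟨s, hs⟩ : ∃ s, 1 - ε < |x s| := by
    by_contra! h
    have h₀ : 0 ≤ 1 - ε := (abs_nonneg _).trans (h 0)
    have := (x.norm_le h₀).2 h
    linarith
  have hu : ∀ k, ‖x * tent s k‖ ≤ 1 := fun k => by
    refine (x * tent s k).norm_le zero_le_one |>.2 fun t => ?_
    have h₁ : ‖x t‖ ≤ 1 := hx ▸ x.norm_coe_le_norm t
    have h₂ : ‖tent s k t‖ ≤ 1 := by
      have h₀ : 0 ≤ tent s k t := le_max_left _ _
      rw [Real.norm_of_nonneg h₀, tent_apply]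
      exact max_le zero_le_one (sub_le_self _ (by positivity))
    rw [ContinuousMap.mul_apply, norm_mul]
    exact mul_le_one₀ h₁ (norm_nonneg _) h₂
  obtain ⟨φ, hφ, hc⟩ := hT.exists_subseq_cauchySeq hu
  obtain ⟨J, hJ⟩ := Metric.cauchySeq_iff'.1 hc (ε / 2) (half_pos hε)
  have h₁ : ∀ᶠ t in 𝓝[≠] s, 1 - ε < |x t| :=
    (x.continuous.abs.continuousAt.eventually (lt_mem_nhds hs)).filter_mono nhdsWithin_le_nhds
  have h₂ : ∀ᶠ t in 𝓝[≠] s, 1 / 2 < tent s (φ J) t := by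
    have : (1 / 2 : ℝ) < tent s (φ J) s := by norm_num [tent_apply]
    exact ((tent s (φ J)).continuous.continuousAt.eventually
      (lt_mem_nhds this)).filter_mono nhdsWithin_le_nhds
  -- All tents equal 1 at `s`, so the reflection must be seen at some `t ≠ s`.
  obtain ⟨t, ⟨ht₁, ht₂⟩, hts⟩ := ((h₁.and h₂).and self_mem_nhdsWithin).exists
  have hd : 0 < dist t s := dist_pos.2 hts
  obtain ⟨m, hm⟩ := exists_nat_gt (1 / dist t s)
  -- The Cauchy bound at `J` is uniform in the later index, so `M` may be chosen after `t`, with the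
  -- narrow tent vanishing there.
  set M := max J m
  have hJM : φ J ≤ φ M := hφ.monotone (le_max_left _ _)
  have hM : tent s (φ M) t = 0 := by
    have h : (m : ℝ) ≤ φ M := by
      exact_mod_cast (le_max_right J m).trans (hφ.id_le M)
    rw [tent_apply, max_eq_left]
    rw [div_lt_iff₀ hd] at hm
    nlinarith
  refine ⟨x * (1 - (2 : ℝ) • (tent s (φ J) - tent s (φ M))), ?_, ?_, t,
    1 - 2 * tent s (φ J) t, by linarith, ht₁.le, ?_⟩
  · refine (ContinuousMap.norm_le _ zero_le_one).2 fun r => ?_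
    have h₁ : ‖x r‖ ≤ 1 := hx ▸ x.norm_coe_le_norm r
    have h₂ := abs_one_sub_two_mul_tent_sub_le s r hJM
    rw [ContinuousMap.mul_apply, norm_mul]
    exact mul_le_one₀ h₁ (norm_nonneg _) (by simpa using h₂)
  · have h : x - x * (1 - (2 : ℝ) • (tent s (φ J) - tent s (φ M))) =
        (2 : ℝ) • (x * tent s (φ J) - x * tent s (φ M)) := by
      ext r
      simp
      ring
    have := hJ M (le_max_left _ _)
    rw [dist_eq_norm, norm_sub_rev] at this
    rw [h, map_smul, map_sub, norm_smul, Real.norm_two]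
    linarith
  · simp [hM]
    ring

theorem bddAbove_localSup_set {E : Type*} [NormedAddCommGroup E] [NormedSpace ℝ E]
    (T : E →L[ℝ] E) (x : E) (lam ε : ℝ) :
    BddAbove {r : ℝ | ∃ y : E, normSeminorm ℝ E y ≤ 1 ∧ ‖T (x - y)‖ ≤ ε ∧
      r = normSeminorm ℝ E ((1 + lam) • T y - lam • y)} := by
  refine ⟨‖(1 + lam) • T - lam • ContinuousLinearMap.id ℝ E‖, ?_⟩
  rintro _ ⟨y, hy, -, rfl⟩
  exact ((1 + lam) • T - lam • ContinuousLinearMap.id ℝ E).unit_le_opNorm y hy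

open unitInterval in
theorem le_localSup {T : C(I, ℝ) →L[ℝ] C(I, ℝ)} (hT : IsCompactOperator T)
    {x : C(I, ℝ)} (hx : ‖x‖ = 1) {lam ε : ℝ} (hlam : 0 < lam) (hε : 0 < ε) :
    (1 + lam) * (1 - 2 * ε - ‖T x - x‖) ≤ localSup (normSeminorm ℝ C(I, ℝ)) T x lam ε := by
  obtain ⟨y, hy, hTy, t, c, hc, hxt, hyt⟩ := exists_reflection hT hx hε
  refine le_csSup_of_le (bddAbove_localSup_set T x lam ε) ⟨y, hy, hTy, rfl⟩ ?_
  refine le_trans ?_ (((1 + lam) • T y - lam • y).norm_coe_le_norm t)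
  have h₁ : |T x t - T y t| ≤ ε := by
    have := (T (x - y)).norm_coe_le_norm t
    rw [map_sub] at this hTy
    exact this.trans hTy
  have h₂ : |T x t - x t| ≤ ‖T x - x‖ := (T x - x).norm_coe_le_norm t
  -- As `c ≤ 0`, the term `-lam * y t` cannot oppose the sign of `x t`.
  have h₃ : (1 + lam) * |x t| ≤ |(1 + lam) * x t - lam * y t| := by
    rw [hyt, show (1 + lam) * x t - lam * (c * x t) = (1 + lam - lam * c) * x t by ring, abs_mul]
    refine mul_le_mul_of_nonneg_right (le_trans ?_ (le_abs_self _)) (abs_nonneg _)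
    nlinarith
  have h₄ : |(1 + lam) * x t - lam * y t| ≤
      |(1 + lam) * T y t - lam * y t| + (1 + lam) * (|T x t - T y t| + |T x t - x t|) := by
    have h : (1 + lam) * x t - lam * y t = ((1 + lam) * T y t - lam * y t) +
        (1 + lam) * ((T x t - T y t) - (T x t - x t)) := by ring
    rw [h]
    refine (abs_add_le _ _).trans ?_
    rw [abs_mul, abs_of_pos (by linarith : 0 < 1 + lam)]
    gcongr
    exact abs_sub _ _
  have h₅ : (1 + lam) * (|T x t - T y t| + |T x t - x t|) ≤ (1 + lam) * (ε + ‖T x - x‖) := by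
    gcongr
  have h₆ : (1 + lam) * (1 - ε) ≤ (1 + lam) * |x t| := by gcongr
  have h₇ : |(1 + lam) * T y t - lam * y t| = ‖((1 + lam) • T y - lam • y) t‖ := by
    simp
  rw [← h₇]
  linarith

theorem mainTheorem11 :
    ∃ N : Seminorm ℝ C(unitInterval, ℝ), IsEquivalentNorm N ∧
      ∀ x : C(unitInterval, ℝ), N x = 1 →
        ∀ T : ℕ → (C(unitInterval, ℝ) →L[ℝ] C(unitInterval, ℝ)),
          (∀ n, IsCompactOperator (T n)) →
          Tendsto (fun n => ‖T n x - x‖) atTop (𝓝 0) →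
          ∀ lam : ℝ, 0 < lam → ¬ LocalApproxCondition N T x lam := by
  refine ⟨normSeminorm ℝ _, ⟨1, one_pos, 1, one_pos, fun u => by simp⟩, ?_⟩
  rintro x hx T hT hTx lam hlam ⟨L, hL, hL₁⟩
  have hle : ∀ n, (1 + lam) * (1 - ‖T n x - x‖) ≤ L n := fun n => by
    have h : Tendsto (fun ε : ℝ => (1 + lam) * (1 - 2 * ε - ‖T n x - x‖)) (𝓝[>] 0)
        (𝓝 ((1 + lam) * (1 - 2 * 0 - ‖T n x - x‖))) :=
      (Continuous.tendsto (by fun_prop) 0).mono_left nhdsWithin_le_nhds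
    rw [mul_zero, sub_zero] at h
    refine le_of_tendsto_of_tendsto h (hL n) ?_
    filter_upwards [self_mem_nhdsWithin] with ε hε
    exact le_localSup (hT n) hx hlam hε
  have := le_of_tendsto_of_tendsto' ((hTx.const_sub 1).const_mul (1 + lam)) hL₁ hle
  linarith
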